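/- For $r\ge 3$, the $r$-dimensional Benes network $BN(r)$ is the graph whose vertices are the pairs $[s,i]$, where $s=s_1\dots s_r$ is an $r$-bit binary string and $i\in\{0,1,\dots,2r\}$ (the level of the vertex). Every edge joins two consecutive levels $j-1$ and $j$, $1\le j\le 2r$, and $[s,j-1]$, $[s',j]$ are adjacent if and only if $s=s'$ or $s$ and $s'$ differ precisely in the $b(j)$-th bit, where $b(j)=j$ for $j\le r$ and $b(j)=2r+1-j$ for $j>r$. For a finite graph $G$ and $k\ge 3$, an edge $k$-general position set of $G$ is a set of edges of $G$ no $k$ of which lie on a common geodesic (shortest path) of $G$, and $k\text{-}\mathrm{gp_e}(G)$ denotes the maximum cardinality of such a set. **Theorem.** Let $r\ge 3$. If $k\in\{3,5\}$, then $$k\text{-}\mathrm{gp_e}(BN(r)) = (k-1)\cdot 2^{r+1}.$$ Moreover, the set of edges incident to vertices of levels $0$ and $2r$ is an edge $3$-general position set of $BN(r)$ of maximum cardinality, and the set of edges incident to vertices of levels $0$, $r$ and $2r$ is an edge $5$-general position set of $BN(r)$ of maximum cardinality. -/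

import Mathlib

/-- A walk is a geodesic (a shortest path, isometric path) if its length is the distance of its
end vertices. Such a walk is automatically a path. -/
def SimpleGraph.Walk.IsGeodesic {V : Type*} {G : SimpleGraph V} {u v : V} (p : G.Walk u v) : Prop :=
  p.length = G.dist u v

/-- `S` is an edge `k`-general position set of `G`: a set of edges of `G` no `k` of which
lie on a common geodesic of `G`. -/
def SimpleGraph.IsEdgeGPSet {V : Type*} (G : SimpleGraph V) (k : ℕ) (S : Set (Sym2 V)) : Prop :=
  S ⊆ G.edgeSet ∧
    ∀ (u v : V) (p : G.Walk u v), p.IsGeodesic → (S ∩ {e | e ∈ p.edges}).ncard < k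

/-- The edge `k`-gp number of a finite graph `G`: the maximum cardinality of an
edge `k`-general position set. -/
noncomputable def SimpleGraph.edgeGPNumber {V : Type*} [Finite V] (G : SimpleGraph V) (k : ℕ) : ℕ :=
  sSup {n : ℕ | ∃ S : Set (Sym2 V), G.IsEdgeGPSet k S ∧ S.ncard = n}

/-- Vertices `[s, i]` of the Benes network: an `r`-bit binary string `s` and a level
`i ∈ {0, 1, …, 2r}`. The bits are numbered `1, …, r`; the `b`-th bit has index `b - 1` in `Fin r`. -/
abbrev BenesVertex (r : ℕ) : Type := (Fin r → Bool) × Fin (2 * r + 1)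

/-- The number of the bit that may change along an edge between the levels `j - 1` and `j`,
`1 ≤ j ≤ 2r`: it is `j` in the first butterfly (`j ≤ r`), and the second butterfly is the mirror
image of the first, level `i` being reflected to level `2r - i`. -/
def benesBit (r j : ℕ) : ℕ := if j ≤ r then j else 2 * r + 1 - j

/-- `v` lies one level above `u`, and the strings of `u` and `v` are equal or differ precisely
in the bit that belongs to these two levels. -/
def BenesStep (r : ℕ) (u v : BenesVertex r) : Prop :=
  v.2.val = u.2.val + 1 ∧
    (u.1 = v.1 ∨ ∀ c : Fin r, u.1 c ≠ v.1 c ↔ c.val + 1 = benesBit r v.2.val)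

/-- The `r`-dimensional Benes network `BN(r)`. -/
def benes (r : ℕ) : SimpleGraph (BenesVertex r) where
  Adj u v := BenesStep r u v ∨ BenesStep r v u
  symm := ⟨fun _ _ h => h.symm⟩
  loopless := ⟨fun u h => by
    rcases h with h | h <;> exact absurd h.1 (by omega)⟩

/-- The edges of `BN(r)` that are incident to a vertex whose level belongs to `L`. -/
def benesEdgesAt (r : ℕ) (L : Set ℕ) : Set (Sym2 (BenesVertex r)) :=
  {e | e ∈ (benes r).edgeSet ∧ ∃ v ∈ e, v.2.val ∈ L}

/-! Upper bound: from each of the 2^r vertices of level 0, go up to level 2r, either always keeping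
or always flipping the bit of the layer. A step changes the level by one, so these 2^(r+1) paths are
geodesics; they cover all edges, and each carries at most k - 1 edges of the set
(`benes_edgeGPSet_ncard_le`).

Lower bound: the extremal sets consist of k - 1 full layers of 2^(r+1) edges each. For a level
function `f` that is constant across these layers, a walk must realise all variation of `f` on its
other edges, so it has at most length minus variation edges in the set
(`Walk.countIn_add_le_of_mem`). The length of a geodesic is bounded by comparison with zigzags;
since layers l and 2r + 1 - l carry the same bit, its range of levels may first be folded at level r
(`benes_geodesic_levels`). The rest is linear arithmetic. -/

namespace SimpleGraph

/-! ### Counting edges of a set along a walk -/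

open Classical in
/-- The number of steps of a walk that traverse an edge of `S`. -/
noncomputable def Walk.countIn {V : Type*} {G : SimpleGraph V} (S : Set (Sym2 V)) {u v : V}
    (p : G.Walk u v) : ℕ :=
  (p.edges.filter (· ∈ S)).length

variable {V : Type*} {G : SimpleGraph V}

/-- Steps are counted with multiplicity, which makes the count additive under concatenation. -/
theorem Walk.ncard_inter_edges_le (S : Set (Sym2 V)) {u v : V} (p : G.Walk u v) :
    (S ∩ {e | e ∈ p.edges}).ncard ≤ p.countIn S := by
  classical
  have h : S ∩ {e | e ∈ p.edges} = ((p.edges.filter (· ∈ S)).toFinset : Set (Sym2 V)) := by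
    ext e
    simp [and_comm]
  rw [h, Set.ncard_coe_finset, Walk.countIn]
  convert List.toFinset_card_le _

theorem Walk.countIn_append (S : Set (Sym2 V)) {u v w : V} (p : G.Walk u v) (q : G.Walk v w) :
    (p.append q).countIn S = p.countIn S + q.countIn S := by
  simp [Walk.countIn, Walk.edges_append]

/-- If `F` is 1-Lipschitz along edges and constant along the edges in `S`, then the variation of
`F` along a walk is bounded by the number of steps outside `S`. -/
theorem Walk.countIn_add_le (S : Set (Sym2 V)) (F : V → ℤ)
    (h1 : ∀ x y, G.Adj x y → |F x - F y| ≤ 1)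
    (h2 : ∀ x y, G.Adj x y → s(x, y) ∈ S → F x = F y) {u v : V} (p : G.Walk u v) :
    (p.countIn S : ℤ) + |F u - F v| ≤ p.length := by
  classical
  induction p with
  | nil => simp [Walk.countIn]
  | @cons u w v h p ih =>
    have key := h1 _ _ h
    have tri : |F u - F v| ≤ |F u - F w| + |F w - F v| := abs_sub_le _ _ _
    by_cases hS : s(u, w) ∈ S
    · have h0 := h2 _ _ h hS
      have : (Walk.cons h p).countIn S = p.countIn S + 1 := by
        simp [Walk.countIn, hS]
      rw [this, h0, Walk.length_cons]
      push_cast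
      linarith
    · have : (Walk.cons h p).countIn S = p.countIn S := by
        simp [Walk.countIn, hS]
      rw [this, Walk.length_cons]
      push_cast
      linarith

/-- A version of `Walk.countIn_add_le` for a walk that visits two given vertices. -/
theorem Walk.countIn_add_le_of_mem (S : Set (Sym2 V)) (F : V → ℤ)
    (h1 : ∀ x y, G.Adj x y → |F x - F y| ≤ 1)
    (h2 : ∀ x y, G.Adj x y → s(x, y) ∈ S → F x = F y) {u v x y : V} (p : G.Walk u v)
    (hx : x ∈ p.support) (hy : y ∈ p.support) :
    (p.countIn S : ℤ) + |F u - F x| + |F x - F y| + |F y - F v| ≤ p.length ∨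
      (p.countIn S : ℤ) + |F u - F y| + |F y - F x| + |F x - F v| ≤ p.length := by
  obtain ⟨q, q', rfl⟩ := Walk.mem_support_iff_exists_append.mp hx
  have key := fun {a b : V} (w : G.Walk a b) => Walk.countIn_add_le S F h1 h2 w
  rcases (Walk.mem_support_append_iff _ _).mp hy with hy | hy
  · obtain ⟨t, t', rfl⟩ := Walk.mem_support_iff_exists_append.mp hy
    right
    have := key t
    have := key t'
    have := key q'
    simp only [Walk.countIn_append, Walk.length_append]
    push_cast
    linarith
  · obtain ⟨t, t', rfl⟩ := Walk.mem_support_iff_exists_append.mp hy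
    left
    have := key t
    have := key t'
    have := key q
    simp only [Walk.countIn_append, Walk.length_append]
    push_cast
    linarith

/-- If every edge in an edge `k`-general position set lies on one of the geodesics of a finite
family, then the set has at most `k - 1` edges for each geodesic of the family. -/
theorem IsEdgeGPSet.ncard_le_of_cover [Finite V] {k : ℕ} {S : Set (Sym2 V)} (hS : G.IsEdgeGPSet k S)
    {ι : Type*} [Fintype ι] (P : ι → Set (Sym2 V))
    (hP : ∀ i, ∃ (u v : V) (p : G.Walk u v), p.IsGeodesic ∧ ∀ e ∈ P i, e ∈ p.edges)
    (hcov : ∀ e ∈ G.edgeSet, ∃ i, e ∈ P i) :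
    S.ncard ≤ (k - 1) * Fintype.card ι := by
  have hsub : S ⊆ ⋃ i, S ∩ P i := by
    intro e he
    obtain ⟨i, hi⟩ := hcov e (hS.1 he)
    exact Set.mem_iUnion.mpr ⟨i, he, hi⟩
  calc S.ncard ≤ (⋃ i, S ∩ P i).ncard := Set.ncard_le_ncard hsub (Set.toFinite _)
    _ ≤ ∑ i, (S ∩ P i).ncard := Set.ncard_iUnion_le_of_fintype _
    _ ≤ ∑ _i : ι, (k - 1) := by
        refine Finset.sum_le_sum fun i _ => ?_
        obtain ⟨u, v, p, hp, hpe⟩ := hP i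
        have h := hS.2 u v p hp
        have h' : (S ∩ P i).ncard ≤ (S ∩ {e | e ∈ p.edges}).ncard :=
          Set.ncard_le_ncard (Set.inter_subset_inter_right _ hpe) (Set.toFinite _)
        omega
    _ = (k - 1) * Fintype.card ι := by simp [mul_comm]

end SimpleGraph

/-! ### Edges as optional bit flips -/

/-- The string `s` with its `b`-th bit flipped if `e` is true. -/
def flipBit {r : ℕ} (e : Bool) (b : ℕ) (s : Fin r → Bool) : Fin r → Bool :=
  fun c => if c.val + 1 = b then xor e (s c) else s c

theorem flipBit_flipBit {r : ℕ} (e : Bool) (b : ℕ) (s : Fin r → Bool) :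
    flipBit e b (flipBit e b s) = s := by
  funext c
  by_cases h : c.val + 1 = b <;> simp [flipBit, h]

theorem flipBit_false {r : ℕ} (b : ℕ) (s : Fin r → Bool) : flipBit false b s = s := by
  funext c
  simp [flipBit]

theorem benesBit_pos {r j : ℕ} (hj : j < 2 * r) : 1 ≤ benesBit r (j + 1) := by
  unfold benesBit
  split_ifs <;> omega

theorem benesBit_le {r j : ℕ} : benesBit r (j + 1) ≤ r := by
  unfold benesBit
  split_ifs <;> omega

theorem benesStep_iff {r : ℕ} {u v : BenesVertex r} :
    BenesStep r u v ↔ v.2.val = u.2.val + 1 ∧ ∃ e, v.1 = flipBit e (benesBit r v.2.val) u.1 := by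
  unfold BenesStep
  refine and_congr_right fun _ => ⟨?_, ?_⟩
  · rintro (h | h)
    · exact ⟨false, by rw [flipBit_false, h]⟩
    · refine ⟨true, funext fun c => ?_⟩
      have := h c
      by_cases hc : c.val + 1 = benesBit r v.2.val
      · have h' := this.mpr hc
        simp only [flipBit, hc, if_true]
        revert h'
        cases u.1 c <;> cases v.1 c <;> simp
      · simp only [flipBit, hc, if_false]
        by_contra hne
        exact hc (this.mp (Ne.symm hne))
  · rintro ⟨e, he⟩
    cases e
    · left
      rw [he, flipBit_false]
    · right
      intro c
      rw [he]
      by_cases hc : c.val + 1 = benesBit r v.2.val <;> simp [flipBit, hc]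

theorem benes_adj_level {r : ℕ} {u v : BenesVertex r} (h : (benes r).Adj u v) :
    v.2.val = u.2.val + 1 ∨ u.2.val = v.2.val + 1 :=
  h.imp (·.1) (·.1)

theorem benes_adj_flipBit {r j : ℕ} (hj : j < 2 * r) (e : Bool) (s : Fin r → Bool) :
    (benes r).Adj (s, ⟨j, by omega⟩) (flipBit e (benesBit r (j + 1)) s, ⟨j + 1, by omega⟩) :=
  Or.inl (benesStep_iff.mpr ⟨rfl, e, rfl⟩)

/-- The edge from `[s, j]` to level `j + 1` that flips the bit iff `e` is true. -/
def benesEdge {r : ℕ} (s : Fin r → Bool) (e : Bool) (j : Fin (2 * r)) : Sym2 (BenesVertex r) :=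
  s((s, ⟨j.val, by omega⟩), (flipBit e (benesBit r (j.val + 1)) s, ⟨j.val + 1, by omega⟩))

theorem benesEdge_mem {r : ℕ} (s : Fin r → Bool) (e : Bool) (j : Fin (2 * r)) :
    benesEdge s e j ∈ (benes r).edgeSet :=
  benes_adj_flipBit j.2 e s

theorem exists_benesEdge {r : ℕ} {e : Sym2 (BenesVertex r)} (he : e ∈ (benes r).edgeSet) :
    ∃ s b j, e = benesEdge s b j := by
  induction e using Sym2.ind with
  | _ u v =>
    have key : ∀ u v : BenesVertex r, BenesStep r u v → ∃ s b j, s(u, v) = benesEdge s b j := by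
      rintro ⟨s, i⟩ ⟨t, j⟩ h
      obtain ⟨h1, b, h2⟩ := benesStep_iff.mp h
      dsimp only at h1 h2
      refine ⟨s, b, ⟨i, by omega⟩, ?_⟩
      obtain ⟨j, hj⟩ := j
      dsimp only at h1 h2
      subst h1 h2
      rfl
    rcases he with h | h
    · exact key u v h
    · rw [Sym2.eq_swap]
      exact key v u h

/-- The levels single out the lower end, and the layer's bit number lies in 1, …, r, so the flip is
visible. -/
theorem benesEdge_injective {r : ℕ} {s s' : Fin r → Bool} {b b' : Bool} {j j' : Fin (2 * r)}
    (h : benesEdge s b j = benesEdge s' b' j') : s = s' ∧ b = b' ∧ j = j' := by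
  unfold benesEdge at h
  rw [Sym2.eq_iff] at h
  simp only [Prod.mk.injEq, Fin.mk.injEq] at h
  rcases h with ⟨⟨hs, hj⟩, hf, -⟩ | ⟨⟨-, hj⟩, -, hj'⟩
  · have hj := Fin.ext hj
    subst hs hj
    refine ⟨rfl, ?_, rfl⟩
    have h1 := benesBit_pos j.2
    have h2 := benesBit_le (r := r) (j := j.val)
    have := congrFun hf ⟨benesBit r (j.val + 1) - 1, by omega⟩
    simpa [flipBit, Nat.sub_add_cancel h1] using this
  · omega

/-! ### Distances -/

/-- Peel off the top layer, letting it correct its bit of `s` to that of `t`. A bit that occurs in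
two layers is thus changed only in the upper one. -/
theorem benes_exists_walk_up {r : ℕ} (n : ℕ) : ∀ (i : ℕ) (hi : i + n ≤ 2 * r) (s t : Fin r → Bool),
    (∀ c, s c ≠ t c → ∃ l, i < l ∧ l ≤ i + n ∧ benesBit r l = c.val + 1) →
    ∃ p : (benes r).Walk (s, ⟨i, by omega⟩) (t, ⟨i + n, by omega⟩), p.length = n := by
  induction n with
  | zero =>
    intro i hi s t h
    have : s = t := by
      funext c
      by_contra hc
      obtain ⟨l, h1, h2, -⟩ := h c hc
      omega
    subst this
    exact ⟨SimpleGraph.Walk.nil, rfl⟩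
  | succ n ih =>
    intro i hi s t h
    have hb : ∃ e, ∀ c : Fin r, c.val + 1 = benesBit r (i + n + 1) → t c = xor e (s c) := by
      have h1 := benesBit_pos (r := r) (j := i + n) (by omega)
      have h2 := benesBit_le (r := r) (j := i + n)
      let c₀ : Fin r := ⟨benesBit r (i + n + 1) - 1, by omega⟩
      refine ⟨xor (t c₀) (s c₀), fun c hc => ?_⟩
      have : c = c₀ := Fin.ext (by simp only [c₀]; omega)
      rw [this]
      cases t c₀ <;> cases s c₀ <;> rfl
    obtain ⟨e, he⟩ := hb
    obtain ⟨p, hp⟩ := ih i (by omega) s (flipBit e (benesBit r (i + n + 1)) t) (by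
      intro c hc
      by_cases hcb : c.val + 1 = benesBit r (i + n + 1)
      · refine absurd ?_ hc
        simp only [flipBit, hcb, if_true, he c hcb]
        cases e <;> simp
      · simp only [flipBit, hcb, if_false] at hc
        obtain ⟨l, h1, h2, h3⟩ := h c hc
        refine ⟨l, h1, ?_, h3⟩
        rcases Nat.lt_or_ge (i + n) l with hl | hl
        · have : l = i + n + 1 := by omega
          subst this
          exact absurd h3.symm hcb
        · exact hl)
    have hadj := benes_adj_flipBit (r := r) (j := i + n) (by omega) e
      (flipBit e (benesBit r (i + n + 1)) t)
    simp only [flipBit_flipBit] at hadj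
    exact ⟨p.concat hadj, by rw [SimpleGraph.Walk.length_concat, hp]⟩

theorem benes_exists_walk_of_le {r : ℕ} {u v : BenesVertex r} (huv : u.2.val ≤ v.2.val)
    (h : ∀ c, u.1 c ≠ v.1 c → ∃ l, u.2.val < l ∧ l ≤ v.2.val ∧ benesBit r l = c.val + 1) :
    ∃ p : (benes r).Walk u v, p.length = v.2.val - u.2.val := by
  obtain ⟨s, i, hi⟩ := u
  obtain ⟨t, j, hj⟩ := v
  dsimp only at huv h ⊢
  obtain ⟨n, rfl⟩ := Nat.exists_eq_add_of_le huv
  obtain ⟨p, hp⟩ := benes_exists_walk_up n i (by omega) s t h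
  exact ⟨p, by omega⟩

/-- If the bits in which `u` and `v` differ all belong to layers between the levels `a` and `b`,
then one can go from `u` to `v` through level `a` first and through level `b` afterwards. -/
theorem benes_dist_le_zigzag {r : ℕ} {u v : BenesVertex r} {a b : ℕ} (ha : a ≤ u.2.val)
    (hab : a ≤ b) (hb : v.2.val ≤ b) (hbr : b ≤ 2 * r)
    (h : ∀ c, u.1 c ≠ v.1 c → ∃ l, a < l ∧ l ≤ b ∧ benesBit r l = c.val + 1) :
    (benes r).dist u v + a + v.2.val + a ≤ u.2.val + b + b := by
  obtain ⟨p, hp⟩ := benes_exists_walk_of_le (r := r) (u := (u.1, ⟨a, by omega⟩)) (v := u) ha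
    (by simp)
  obtain ⟨q, hq⟩ := benes_exists_walk_of_le (r := r) (u := (u.1, ⟨a, by omega⟩))
    (v := (v.1, ⟨b, by omega⟩)) hab h
  obtain ⟨w, hw⟩ := benes_exists_walk_of_le (r := r) (u := v) (v := (v.1, ⟨b, by omega⟩)) hb
    (by simp)
  have := SimpleGraph.dist_le (p.reverse.append (q.append w.reverse))
  simp only [SimpleGraph.Walk.length_append, SimpleGraph.Walk.length_reverse, hp, hq, hw] at this
  omega

/-- A bit changes only on a step through one of its layers, and a layer is numbered by its upper
level. -/
theorem benes_exists_layer_of_walk {r : ℕ} {u v : BenesVertex r} (p : (benes r).Walk u v)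
    {m M : ℕ} (hm : ∀ x ∈ p.support, m ≤ x.2.val) (hM : ∀ x ∈ p.support, x.2.val ≤ M) (c : Fin r)
    (hc : u.1 c ≠ v.1 c) : ∃ l, m < l ∧ l ≤ M ∧ benesBit r l = c.val + 1 := by
  induction p with
  | nil => exact absurd rfl hc
  | @cons u w v h p ih =>
    simp only [SimpleGraph.Walk.support_cons, List.mem_cons, forall_eq_or_imp] at hm hM
    by_cases hw : w.1 c = v.1 c
    · rw [← hw] at hc
      have hwm := hm.2 w p.start_mem_support
      have hwM := hM.2 w p.start_mem_support
      rcases h with h | h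
      · obtain ⟨h1, e, he⟩ := benesStep_iff.mp h
        refine ⟨w.2.val, by omega, hwM, ?_⟩
        by_contra hne
        exact hc (by simp [he, flipBit, Ne.symm hne])
      · obtain ⟨h1, e, he⟩ := benesStep_iff.mp h
        refine ⟨u.2.val, by omega, hM.1, ?_⟩
        by_contra hne
        exact hc (by simp [he, flipBit, Ne.symm hne])
    · exact ih hm.2 hM.2 hw

/-- A geodesic whose levels range over `m, …, M` is not longer than a zigzag between any two
levels `a` and `b` whose layers contain the bits of the layers between the levels `m` and `M`. -/
theorem benes_geodesic_length_le {r : ℕ} {u v : BenesVertex r} {p : (benes r).Walk u v}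
    (hp : p.IsGeodesic) {m M a b : ℕ} (hm : ∀ x ∈ p.support, m ≤ x.2.val)
    (hM : ∀ x ∈ p.support, x.2.val ≤ M) (hau : a ≤ u.2.val) (hav : a ≤ v.2.val)
    (hbu : u.2.val ≤ b) (hbv : v.2.val ≤ b) (hbr : b ≤ 2 * r)
    (hcov : ∀ l, m < l → l ≤ M → ∃ l', a < l' ∧ l' ≤ b ∧ benesBit r l' = benesBit r l) :
    p.length + a + v.2.val + a ≤ u.2.val + b + b ∧
      p.length + a + u.2.val + a ≤ v.2.val + b + b := by
  have key : ∀ c, u.1 c ≠ v.1 c → ∃ l, a < l ∧ l ≤ b ∧ benesBit r l = c.val + 1 := by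
    intro c hc
    obtain ⟨l, h1, h2, h3⟩ := benes_exists_layer_of_walk p hm hM c hc
    obtain ⟨l', h1', h2', h3'⟩ := hcov l h1 h2
    exact ⟨l', h1', h2', h3'.trans h3⟩
  rw [hp]
  refine ⟨benes_dist_le_zigzag hau (by omega) hbv hbr key, ?_⟩
  rw [SimpleGraph.dist_comm]
  exact benes_dist_le_zigzag hav (by omega) hbu hbr fun c hc => key c hc.symm

/-- The level data of a geodesic: its ends have levels `i ≤ j` (after reversal, if necessary), its
levels range from `m` to `M`, and its length is bounded by zigzags between `m` and `M` and between
the two intervals obtained by folding the range at level `r`. A level function `f` that is constant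
on the layers of `S` bounds from below the number of its edges outside `S`. -/
theorem benes_geodesic_levels {r : ℕ} {u v : BenesVertex r} {p : (benes r).Walk u v}
    (hp : p.IsGeodesic) (S : Set (Sym2 (BenesVertex r))) (f : ℕ → ℤ)
    (h1 : ∀ l, l < 2 * r → |f l - f (l + 1)| ≤ 1)
    (h2 : ∀ s e (l : Fin (2 * r)), benesEdge s e l ∈ S → f l.val = f (l.val + 1))
    (hf : Monotone f) :
    ∃ i j m M : ℕ, m ≤ i ∧ m ≤ j ∧ i ≤ M ∧ j ≤ M ∧ i ≤ j ∧ M ≤ 2 * r ∧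
      (∀ a b : ℕ, (a = m ∧ b = M ∨
          a = min (min i j) (min m (2 * r - M)) ∧ b = max (max i j) r ∨
          a = min (min i j) r ∧ b = max (max i j) (max M (2 * r - m))) →
        p.length + a + j + a ≤ i + b + b) ∧
      (p.countIn S : ℤ) + 2 * (f M - f m) + f i - f j ≤ p.length := by
  classical
  have hne : p.support.toFinset.Nonempty := ⟨u, by simp⟩
  obtain ⟨x, hx, hxm⟩ := p.support.toFinset.exists_min_image (fun x => x.2.val) hne
  obtain ⟨y, hy, hyM⟩ := p.support.toFinset.exists_max_image (fun x => x.2.val) hne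
  simp only [List.mem_toFinset] at hx hxm hy hyM
  have hmu := hxm u p.start_mem_support
  have hmv := hxm v p.end_mem_support
  have hMu := hyM u p.start_mem_support
  have hMv := hyM v p.end_mem_support
  have hL : ∀ a b : ℕ, (a = x.2.val ∧ b = y.2.val ∨
      a = min (min u.2.val v.2.val) (min x.2.val (2 * r - y.2.val)) ∧
        b = max (max u.2.val v.2.val) r ∨
      a = min (min u.2.val v.2.val) r ∧
        b = max (max u.2.val v.2.val) (max y.2.val (2 * r - x.2.val))) →
      p.length + a + v.2.val + a ≤ u.2.val + b + b ∧
        p.length + a + u.2.val + a ≤ v.2.val + b + b := by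
    intro a b hab
    refine benes_geodesic_length_le hp hxm hyM ?_ ?_ ?_ ?_ ?_ ?_
    · omega
    · omega
    · omega
    · omega
    · omega
    · intro l hl hl'
      have hfold : benesBit r (2 * r + 1 - l) = benesBit r l := by
        unfold benesBit
        split_ifs <;> omega
      rcases hab with hab | hab | hab
      · exact ⟨l, by omega, by omega, rfl⟩
      · rcases Nat.lt_or_ge r l with h | h
        · exact ⟨2 * r + 1 - l, by omega, by omega, hfold⟩
        · exact ⟨l, by omega, by omega, rfl⟩
      · rcases Nat.lt_or_ge r l with h | h
        · exact ⟨l, by omega, by omega, rfl⟩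
        · exact ⟨2 * r + 1 - l, by omega, by omega, hfold⟩
  have hV := SimpleGraph.Walk.countIn_add_le_of_mem S (fun x => f x.2.val) (by
      intro x y hxy
      rcases benes_adj_level hxy with h | h
      · rw [h]
        exact h1 _ (by omega)
      · rw [h, abs_sub_comm]
        exact h1 _ (by omega)) (by
      intro x y hxy hS
      obtain ⟨s, e, l, hl⟩ := exists_benesEdge (e := s(x, y)) hxy
      rw [hl] at hS
      have := h2 s e l hS
      unfold benesEdge at hl
      rw [Sym2.eq_iff] at hl
      rcases hl with ⟨rfl, rfl⟩ | ⟨rfl, rfl⟩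
      · exact this
      · exact this.symm) p hx hy
  have hiM := hf hMu
  have hjM := hf hMv
  have him := hf hmu
  have hjm := hf hmv
  have hmM := hf (hmu.trans hMu)
  have hyr : y.2.val ≤ 2 * r := by omega
  simp only [abs_of_nonneg, abs_of_nonpos, sub_nonneg, sub_nonpos, hiM, hjM, him, hjm, hmM] at hV
  -- Of the two visiting orders in `hV`, the one with less variation is kept; monotonicity of `f`
  -- decides which.
  rcases le_total u.2.val v.2.val with huv | huv
  · refine ⟨u.2.val, v.2.val, x.2.val, y.2.val, hmu, hmv, hMu, hMv, huv, hyr,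
      fun a b hab => (hL a b hab).1, ?_⟩
    have := hf huv
    omega
  · refine ⟨v.2.val, u.2.val, x.2.val, y.2.val, hmv, hmu, hMv, hMu, huv, hyr,
      fun a b hab => (hL a b (by rwa [max_comm u.2.val, min_comm u.2.val])).2, ?_⟩
    have := hf huv
    omega

/-! ### General position of the layer sets -/

theorem benesEdge_mem_benesEdgesAt {r : ℕ} {L : Set ℕ} {s : Fin r → Bool} {e : Bool}
    {l : Fin (2 * r)} : benesEdge s e l ∈ benesEdgesAt r L ↔ l.val ∈ L ∨ l.val + 1 ∈ L := by
  unfold benesEdgesAt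
  simp only [Set.mem_ofPred_eq, benesEdge_mem, true_and]
  unfold benesEdge
  simp

theorem benes_isEdgeGPSet_three {r : ℕ} (hr : 3 ≤ r) :
    (benes r).IsEdgeGPSet 3 (benesEdgesAt r {0, 2 * r}) := by
  refine ⟨fun e he => he.1, fun u v p hp => ?_⟩
  refine (p.ncard_inter_edges_le _).trans_lt ?_
  -- `f` is the level after contracting the first and last layers; truncated subtraction gives f 0 =
  -- f 1 = 0.
  obtain ⟨i, j, m, M, h1, h2, h3, h4, h5, h6, hL, hV⟩ := benes_geodesic_levels hp
    (benesEdgesAt r {0, 2 * r}) (fun x => ((min (x - 1) (2 * r - 2) : ℕ) : ℤ))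
    (by intro l hl; rw [abs_le]; omega)
    (by
      intro s e l h
      rw [benesEdge_mem_benesEdgesAt] at h
      simp only [Set.mem_insert_iff, Set.mem_singleton_iff] at h
      omega)
    (by intro x y hxy; dsimp only; omega)
  have ha := hL _ _ (Or.inl ⟨rfl, rfl⟩)
  have hb := hL _ _ (Or.inr (Or.inl ⟨rfl, rfl⟩))
  have hc := hL _ _ (Or.inr (Or.inr ⟨rfl, rfl⟩))
  clear hL
  generalize p.countIn _ = k at *
  generalize p.length = n at *
  omega

set_option maxHeartbeats 1000000 in
theorem benes_isEdgeGPSet_five {r : ℕ} (hr : 3 ≤ r) :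
    (benes r).IsEdgeGPSet 5 (benesEdgesAt r {0, r, 2 * r}) := by
  refine ⟨fun e he => he.1, fun u v p hp => ?_⟩
  refine (p.ncard_inter_edges_le _).trans_lt ?_
  -- Here the two layers next to level `r` are contracted as well: each summand climbs by r - 2
  -- inside one half.
  obtain ⟨i, j, m, M, h1, h2, h3, h4, h5, h6, hL, hV⟩ := benes_geodesic_levels hp
    (benesEdgesAt r {0, r, 2 * r})
    (fun x => ((min (x - 1) (r - 2) + min (x - (r + 1)) (r - 2) : ℕ) : ℤ))
    (by intro l hl; rw [abs_le]; omega)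
    (by
      intro s e l h
      rw [benesEdge_mem_benesEdgesAt] at h
      simp only [Set.mem_insert_iff, Set.mem_singleton_iff] at h
      omega)
    (by intro x y hxy; dsimp only; omega)
  have ha := hL _ _ (Or.inl ⟨rfl, rfl⟩)
  have hb := hL _ _ (Or.inr (Or.inl ⟨rfl, rfl⟩))
  have hc := hL _ _ (Or.inr (Or.inr ⟨rfl, rfl⟩))
  clear hL
  generalize p.countIn _ = k at *
  generalize p.length = n at *
  have hlow : ∀ x, x ≤ r → min (x - 1) (r - 2) + min (x - (r + 1)) (r - 2) = min (x - 1) (r - 2) := by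
    omega
  have hhigh : ∀ x, r ≤ x →
      min (x - 1) (r - 2) + min (x - (r + 1)) (r - 2) = r - 2 + min (x - (r + 1)) (r - 2) := by
    omega
  rw [min_eq_left h5, max_eq_right h5] at hb hc
  -- A range within one half needs only the zigzag between `m` and `M`. If the range crosses level
  -- `r` but both ends lie in one half, the fold into that half suffices; otherwise all three bounds
  -- are used.
  rcases le_total M r with hM | hM
  · rw [hlow M hM, hlow m (by omega), hlow i (by omega), hlow j (by omega)] at hV
    clear hlow hhigh hb hc
    omega
  rcases le_total r m with hm | hm
  · rw [hhigh M hM, hhigh m (by omega), hhigh i (by omega), hhigh j (by omega)] at hV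
    clear hlow hhigh hb hc
    omega
  rw [hhigh M hM, hlow m hm] at hV
  rcases le_total j r with hj | hj
  · rw [hlow i (by omega), hlow j hj] at hV
    rw [max_eq_right hj] at hb
    clear hlow hhigh ha hc
    omega
  rcases le_total r i with hi | hi
  · rw [hhigh i hi, hhigh j hj] at hV
    rw [min_eq_right hi] at hc
    clear hlow hhigh ha hb
    omega
  rw [hlow i hi, hhigh j hj] at hV
  rw [max_eq_left hj] at hb
  rw [min_eq_left hi] at hc
  clear hlow hhigh
  omega

/-! ### The covering by geodesics from level `0` to level `2 * r` -/

/-- The string at level `n` of the path that starts in `[s, 0]` and flips the bit of each layer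
if `e` is true and none of them otherwise. -/
def benesPathString {r : ℕ} (e : Bool) (s : Fin r → Bool) : ℕ → Fin r → Bool
  | 0 => s
  | n + 1 => flipBit e (benesBit r (n + 1)) (benesPathString e s n)

theorem benesPathString_surjective {r : ℕ} (e : Bool) (n : ℕ) (t : Fin r → Bool) :
    ∃ s, benesPathString e s n = t := by
  induction n generalizing t with
  | zero => exact ⟨t, rfl⟩
  | succ n ih =>
    obtain ⟨s, hs⟩ := ih (flipBit e (benesBit r (n + 1)) t)
    exact ⟨s, by rw [benesPathString, hs, flipBit_flipBit]⟩

theorem benes_exists_walk_path {r : ℕ} (e : Bool) (s : Fin r → Bool) (n : ℕ) (hn : n ≤ 2 * r) :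
    ∃ p : (benes r).Walk (s, ⟨0, by omega⟩) (benesPathString e s n, ⟨n, by omega⟩),
      p.length = n ∧
        ∀ l : Fin (2 * r), l.val < n → benesEdge (benesPathString e s l) e l ∈ p.edges := by
  induction n with
  | zero => exact ⟨SimpleGraph.Walk.nil, rfl, fun l hl => absurd hl (by omega)⟩
  | succ n ih =>
    obtain ⟨p, hp, hpe⟩ := ih (by omega)
    have hadj : (benes r).Adj (benesPathString e s n, ⟨n, by omega⟩)
        (benesPathString e s (n + 1), ⟨n + 1, by omega⟩) := benes_adj_flipBit (by omega) e _
    refine ⟨p.concat hadj, ?_, ?_⟩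
    · rw [SimpleGraph.Walk.length_concat, hp]
    · intro l hl
      rw [SimpleGraph.Walk.edges_concat, List.concat_eq_append, List.mem_append]
      rcases Nat.lt_or_ge l.val n with h | h
      · exact Or.inl (hpe l h)
      · obtain ⟨l, hl'⟩ := l
        obtain rfl : l = n := le_antisymm (Nat.lt_succ_iff.mp hl) h
        right
        simp [benesEdge, benesPathString]

/-- This makes the covering paths of length 2r geodesics. -/
theorem benes_level_sub_le_length {r : ℕ} {u v : BenesVertex r} (p : (benes r).Walk u v) :
    v.2.val ≤ u.2.val + p.length := by
  induction p with
  | nil => simp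
  | cons h p ih =>
    rw [SimpleGraph.Walk.length_cons]
    rcases benes_adj_level h with h | h <;> omega

theorem benes_edgeGPSet_ncard_le {r k : ℕ} {S : Set (Sym2 (BenesVertex r))}
    (hS : (benes r).IsEdgeGPSet k S) : S.ncard ≤ (k - 1) * 2 ^ (r + 1) := by
  have h := hS.ncard_le_of_cover
    (fun x : (Fin r → Bool) × Bool => Set.range fun l : Fin (2 * r) => benesEdge (benesPathString x.2 x.1 l) x.2 l)
    (by
      rintro ⟨s, e⟩
      obtain ⟨p, hp, hpe⟩ := benes_exists_walk_path e s (2 * r) le_rfl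
      refine ⟨_, _, p, ?_, ?_⟩
      · refine le_antisymm ?_ (SimpleGraph.dist_le p)
        obtain ⟨q, hq⟩ := p.reachable.exists_walk_length_eq_dist
        have := benes_level_sub_le_length q
        rw [← hq, hp]
        simpa using this
      · rintro _ ⟨l, rfl⟩
        exact hpe l l.2)
    (by
      intro f hf
      obtain ⟨t, e, l, rfl⟩ := exists_benesEdge hf
      obtain ⟨s, rfl⟩ := benesPathString_surjective e l.val t
      exact ⟨(s, e), l, rfl⟩)
  simpa [pow_succ] using h

/-! ### Cardinalities and conclusion -/

theorem benesEdgesAt_le_ncard {r : ℕ} (L : Set ℕ) (J : Finset (Fin (2 * r)))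
    (hJ : ∀ l ∈ J, l.val ∈ L ∨ l.val + 1 ∈ L) :
    J.card * 2 ^ (r + 1) ≤ (benesEdgesAt r L).ncard := by
  classical
  let T : Finset (((Fin r → Bool) × Bool) × Fin (2 * r)) := Finset.univ ×ˢ J
  have hinj : Function.Injective
      fun x : ((Fin r → Bool) × Bool) × Fin (2 * r) => benesEdge x.1.1 x.1.2 x.2 := by
    rintro ⟨⟨s, b⟩, j⟩ ⟨⟨s', b'⟩, j'⟩ h
    obtain ⟨rfl, rfl, rfl⟩ := benesEdge_injective h
    rfl
  have hT : T.card = J.card * 2 ^ (r + 1) := by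
    simp [T, pow_succ, mul_comm]
  rw [← hT, ← Finset.card_image_of_injective T hinj, ← Set.ncard_coe_finset]
  refine Set.ncard_le_ncard ?_ (Set.toFinite _)
  intro f hf
  simp only [Finset.coe_image, Set.mem_image, Finset.mem_coe] at hf
  obtain ⟨x, hx, rfl⟩ := hf
  exact benesEdge_mem_benesEdgesAt.mpr (hJ _ (Finset.mem_product.mp hx).2)

theorem benes_edgeGPNumber_eq {r k : ℕ} {S : Set (Sym2 (BenesVertex r))}
    (hS : (benes r).IsEdgeGPSet k S) (hle : (k - 1) * 2 ^ (r + 1) ≤ S.ncard) :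
    (benes r).edgeGPNumber k = (k - 1) * 2 ^ (r + 1) ∧
      S.ncard = (benes r).edgeGPNumber k := by
  have hSe := le_antisymm (benes_edgeGPSet_ncard_le hS) hle
  have hmax : IsGreatest {n : ℕ | ∃ S, (benes r).IsEdgeGPSet k S ∧ S.ncard = n}
      ((k - 1) * 2 ^ (r + 1)) := by
    refine ⟨⟨S, hS, hSe⟩, ?_⟩
    rintro n ⟨T, hT, rfl⟩
    exact benes_edgeGPSet_ncard_le hT
  have heq : (benes r).edgeGPNumber k = (k - 1) * 2 ^ (r + 1) := hmax.csSup_eq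
  exact ⟨heq, hSe.trans heq.symm⟩

theorem theorem5p2 (r : ℕ) (hr : 3 ≤ r) :
    (∀ k : ℕ, k = 3 ∨ k = 5 → (benes r).edgeGPNumber k = (k - 1) * 2 ^ (r + 1)) ∧
    ((benes r).IsEdgeGPSet 3 (benesEdgesAt r {0, 2 * r}) ∧
      (benesEdgesAt r {0, 2 * r}).ncard = (benes r).edgeGPNumber 3) ∧
    ((benes r).IsEdgeGPSet 5 (benesEdgesAt r {0, r, 2 * r}) ∧
      (benesEdgesAt r {0, r, 2 * r}).ncard = (benes r).edgeGPNumber 5) := by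
  have h3 := benes_edgeGPNumber_eq (benes_isEdgeGPSet_three hr) (by
    refine le_trans (le_of_eq ?_) (benesEdgesAt_le_ncard _
      {⟨0, by omega⟩, ⟨2 * r - 1, by omega⟩} ?_)
    · rw [Finset.card_pair (by simp only [ne_eq, Fin.mk.injEq]; omega)]
    · simp only [Finset.mem_insert, Finset.mem_singleton, Set.mem_insert_iff,
        Set.mem_singleton_iff, forall_eq_or_imp, forall_eq]
      grind)
  have h5 := benes_edgeGPNumber_eq (benes_isEdgeGPSet_five hr) (by
    -- Index `l` stands for the layer between levels `l` and `l + 1`, so level `r` contributes both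
    -- r - 1 and r.
    refine le_trans (le_of_eq ?_) (benesEdgesAt_le_ncard _
      {⟨0, by omega⟩, ⟨r - 1, by omega⟩, ⟨r, by omega⟩, ⟨2 * r - 1, by omega⟩} ?_)
    · rw [Finset.card_insert_of_notMem, Finset.card_insert_of_notMem, Finset.card_pair]
      all_goals
        simp only [Finset.mem_insert, Finset.mem_singleton, ne_eq, Fin.mk.injEq]
        omega
    · simp only [Finset.mem_insert, Finset.mem_singleton, Set.mem_insert_iff,
        Set.mem_singleton_iff, forall_eq_or_imp, forall_eq]
      grind)
  refine ⟨?_, ⟨benes_isEdgeGPSet_three hr, h3.2⟩, benes_isEdgeGPSet_five hr, h5.2⟩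
  rintro k (rfl | rfl)
  · exact h3.1
  · exact h5.1
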